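/- Let $\mathcal G\subseteq\mathbb N$ be a set (finite or infinite) whose distinct elements are pairwise coprime, and let $\mathcal H=\{h_1,\dots,h_u\}$ be a finite set of integers. For $g\in\mathcal G$ let $\nu_g(\mathcal H)$ be the number of distinct residue classes modulo $g$ occupied by the elements of $\mathcal H$, and suppose that $\mathcal H$ is admissible with respect to $\mathcal G$, i.e. $\nu_g(\mathcal H)<g$ for all $g\in\mathcal G$. Put $$\mathcal V=\{n\in\mathbb N:\ n\not\equiv h_t \pmod g\ \text{ for all } t\le u \text{ and all } g\in\mathcal G\}.$$ Let $\mathcal A$ be the set consisting of $1$ and of all products $g_1\cdots g_s$ ($s\ge 1$) of distinct elements of $\mathcal G$. Let $\theta\in(0,1)$, let $A,B,\varepsilon>0$ be constants with $\varepsilon<A$, and write $\mathcal A_n=\{a\in\mathcal A: a\le n^A\}$. Suppose that $\mathcal A_n$ meets Condition A with exponent $\theta$ for large $n$, i.e. there is a constant $C$ such that for all sufficiently large $n\in\mathbb N$ $$a\le C n^{A}\ \text{ for all } a\in\mathcal A_n,\qquad\text{and}\qquad |\mathcal A_n\cap[1,y]|\le C\,\frac{y^{\theta}}{(\log y)^{B}}\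 \text{ for all real } y\ge C n^{\varepsilon}.$$ Let $\alpha\in(0,1)$ and let $(P_i)_{i\ge 0}$ be an $\alpha$-random walk on $\mathbb N$: $P_0=0$ and $P_i=P_{i-1}+W_i$ for $i\ge1$, where $W_1,W_2,\dots$ are independent random variables with $\mathbb P(W_i=1)=\alpha$ and $\mathbb P(W_i=0)=1-\alpha$. Then the product $$c=\prod_{g\in\mathcal G}\left(1-\frac{\nu_g(\mathcal H)}{g}\right)$$ converges (unconditionally), and almost surely $$\lim_{n\to\infty}\frac{\#\{1\le i\le n:\ P_i\in\mathcal V\}}{n}=c .$$ In particular the limit does not depend on $\alpha$. -/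

import Mathlib

open MeasureTheory ProbabilityTheory Filter Topology

noncomputable section

/-- The number `ν_g(H)` of distinct residue classes modulo `g` occupied by the elements of `H`. -/
def residueCount (H : Finset ℤ) (g : ℕ) : ℕ :=
  (H.image (fun h : ℤ => (h : ZMod g))).card

/-- `H` is admissible with respect to `G`. (This forces every `g ∈ G` to be positive.) -/
def IsAdmissible (H : Finset ℤ) (G : Set ℕ) : Prop :=
  ∀ g ∈ G, residueCount H g < g

/-- The set of natural numbers sieved by `G` with respect to `H`. -/
def sievedSet (G : Set ℕ) (H : Finset ℤ) : Set ℕ :=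
  {n : ℕ | ∀ h ∈ H, ∀ g ∈ G, ¬ ((n : ℤ) ≡ h [ZMOD (g : ℤ)])}

/-- The set of all products of finitely many distinct elements of `G`; the empty product gives
`1`. -/
def distinctProducts (G : Set ℕ) : Set ℕ :=
  {a : ℕ | ∃ s : Finset ℕ, (s : Set ℕ) ⊆ G ∧ a = ∏ g ∈ s, g}

/-- The truncation of `distinctProducts G` to the elements not exceeding `x ^ A`. -/
def truncatedProducts (G : Set ℕ) (A x : ℝ) : Set ℕ :=
  {a ∈ distinctProducts G | (a : ℝ) ≤ x ^ A}

/-- The set `S` of positive integers meets Condition A with exponent `θ` at the parameter `x`: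
`a ≪ x ^ A` for all `a ∈ S`, and `|S ∩ [1, y]| ≪ y ^ θ / (log y) ^ B` for all `y ≫ x ^ ε`.
All the implied constants are at most `C`. -/
structure ConditionA (C A B ε θ x : ℝ) (S : Set ℕ) : Prop where
  pos : ∀ a ∈ S, 0 < a
  le_pow : ∀ a ∈ S, (a : ℝ) ≤ C * x ^ A
  card_le : ∀ y : ℝ, C * x ^ ε ≤ y →
    (Set.ncard {a ∈ S | (a : ℝ) ≤ y} : ℝ) ≤ C * (y ^ θ / Real.log y ^ B)

/-- `P` is an `α`-random walk on `ℕ`: it starts at `0` and its steps are independent Bernoulli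
variables with success probability `α`. -/
structure IsAlphaRandomWalk {Ω : Type*} [MeasurableSpace Ω] (μ : Measure Ω) (α : ℝ)
    (P : ℕ → Ω → ℕ) : Prop where
  start : ∀ ω, P 0 ω = 0
  step : ∃ W : ℕ → Ω → ℕ,
    (∀ i, Measurable (W i)) ∧
    iIndepFun W μ ∧
    (∀ i, μ {ω | W i ω = 1} = ENNReal.ofReal α) ∧
    (∀ i, μ {ω | W i ω = 0} = ENNReal.ofReal (1 - α)) ∧
    ∀ i ω, P (i + 1) ω = P i ω + W i ω

/-- The proportion of time among the first `n` steps that the path `p` spends in `V`. -/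
def visitProportion (V : Set ℕ) (p : ℕ → ℕ) (n : ℕ) : ℝ :=
  (∑ i ∈ Finset.Icc 1 n, V.indicator (fun _ => (1 : ℝ)) (p i)) / n

end

/-! Two independent facts combine: the walk samples any set `V` that has a natural density `d` with
frequency `d`, and the sieved set has density `c`.

For the first, sum `1_V(P_i) (W_i - α)` over the first `n` steps, where `W_i` is the step taken from
`P_i`. The walk climbs by unit steps, so it leaves each point below `P_n` exactly once; the sum is
therefore `#(V ∩ [0, P_n)) - α #{i < n : P_i ∈ V}` (`compensatedSum_eq`). Its terms are orthogonal,
so its second moment is at most `n` and it is almost surely `o(n)`. Taking `V = ℕ` gives `P_n / n →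
α`; for general `V` the visits number `α⁻¹ · d · α n + o(n)`, and `α` cancels.

For the second, Condition A, applied only to the moduli themselves, makes their reciprocals
summable. Finitely many moduli are handled by periodicity and the Chinese remainder theorem; the
remaining ones remove a set of small upper density (`abs_sum_indicator_sievedSet_sub_le`). -/

/-! ### A second-moment strong law of large numbers. -/

/-- A real sequence with increments bounded by `1` that is `o(n)` along the squares is `o(n)`. -/
lemma tendsto_div_of_tendsto_sq_div {x : ℕ → ℝ} (hx : ∀ n, |x (n + 1) - x n| ≤ 1)
    (h : Tendsto (fun k : ℕ => x (k ^ 2) / (k : ℝ) ^ 2) atTop (𝓝 0)) :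
    Tendsto (fun n : ℕ => x n / n) atTop (𝓝 0) := by
  have hdiff : ∀ m d, |x (m + d) - x m| ≤ d := by
    intro m d
    induction d with
    | zero => simp
    | succ d ih =>
      calc |x (m + (d + 1)) - x m| = |(x (m + d + 1) - x (m + d)) + (x (m + d) - x m)| := by
            rw [← add_assoc]; congr 1; ring
        _ ≤ 1 + d := (abs_add_le _ _).trans (add_le_add (hx _) ih)
        _ = ((d + 1 : ℕ) : ℝ) := by push_cast; ring
  have hsqrt : Tendsto Nat.sqrt atTop atTop :=
    tendsto_atTop.2 fun b => (eventually_ge_atTop (b * b)).mono fun n hn => Nat.le_sqrt.2 hn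
  -- With `k = √n` rounded down, `n` exceeds `k²` by at most `2k`, so the drift since the last
  -- square costs `2k / k²`.
  have hbound : Tendsto (fun k : ℕ => |x (k ^ 2) / (k : ℝ) ^ 2| + 2 / (k : ℝ)) atTop (𝓝 0) := by
    simpa using h.abs.add (tendsto_const_div_atTop_nhds_zero_nat (2 : ℝ))
  refine squeeze_zero_norm' ?_ (hbound.comp hsqrt)
  filter_upwards [eventually_ge_atTop 1] with n hn
  set k := n.sqrt with hk
  have hk1 : 1 ≤ k := Nat.le_sqrt.2 (by simpa using hn)
  have hk2 : k ^ 2 ≤ n := Nat.sqrt_le' n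
  have hk3 : n ≤ k ^ 2 + 2 * k := by
    have := Nat.sqrt_le_add n
    rw [← hk] at this
    nlinarith
  simp only [Function.comp_apply, Real.norm_eq_abs, ← hk]
  clear_value k
  obtain ⟨d, rfl⟩ := Nat.exists_eq_add_of_le hk2
  have hd : (d : ℝ) ≤ 2 * k := by
    have : d ≤ 2 * k := by omega
    exact_mod_cast this
  have hk0 : (0 : ℝ) < k := by exact_mod_cast hk1
  have hxn : |x (k ^ 2 + d)| ≤ |x (k ^ 2)| + 2 * k := by
    have h1 := hdiff (k ^ 2) d
    have h2 := abs_sub_abs_le_abs_sub (x (k ^ 2 + d)) (x (k ^ 2))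
    linarith
  have hkn : (k : ℝ) ^ 2 ≤ ((k ^ 2 + d : ℕ) : ℝ) := by exact_mod_cast hk2
  rw [abs_div, abs_div, Nat.abs_cast, abs_of_pos (pow_pos hk0 2)]
  calc |x (k ^ 2 + d)| / ((k ^ 2 + d : ℕ) : ℝ) ≤ |x (k ^ 2 + d)| / (k : ℝ) ^ 2 := by gcongr
    _ ≤ (|x (k ^ 2)| + 2 * k) / (k : ℝ) ^ 2 := by gcongr
    _ = |x (k ^ 2)| / (k : ℝ) ^ 2 + 2 / k := by field_simp

/-- A strong law of large numbers: a process with increments bounded by `1` whose second moments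
grow at most linearly is almost surely `o(n)`. -/
lemma ae_tendsto_div_of_integral_sq_le {Ω : Type*} [MeasurableSpace Ω] {μ : Measure Ω}
    {X : ℕ → Ω → ℝ} (hmeas : ∀ n, Measurable (X n))
    (hinc : ∀ n ω, |X (n + 1) ω - X n ω| ≤ 1)
    (hint : ∀ n, Integrable (fun ω => X n ω ^ 2) μ)
    (hsq : ∀ n, ∫ ω, X n ω ^ 2 ∂μ ≤ n) :
    ∀ᵐ ω ∂μ, Tendsto (fun n : ℕ => X n ω / n) atTop (𝓝 0) := by
  have hterm : ∀ k : ℕ, ∫⁻ ω, ENNReal.ofReal ((X (k ^ 2) ω / (k : ℝ) ^ 2) ^ 2) ∂μ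
      ≤ ENNReal.ofReal (1 / (k : ℝ) ^ 2) := by
    intro k
    simp only [div_pow]
    rw [← ofReal_integral_eq_lintegral_ofReal ((hint (k ^ 2)).div_const _)
      (ae_of_all _ fun ω => by positivity), integral_div]
    apply ENNReal.ofReal_le_ofReal
    rcases Nat.eq_zero_or_pos k with rfl | hk
    · simp
    have hk0 : (0 : ℝ) < k := by exact_mod_cast hk
    have := hsq (k ^ 2)
    push_cast at this
    calc _ ≤ (k : ℝ) ^ 2 / ((k : ℝ) ^ 2) ^ 2 := by gcongr
      _ = _ := by field_simp
  have hsum : ∑' k : ℕ, ENNReal.ofReal (1 / (k : ℝ) ^ 2) ≠ ⊤ :=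
    ((Real.summable_one_div_nat_pow (p := 2)).2 one_lt_two).tsum_ofReal_ne_top
  have hm : ∀ k : ℕ, Measurable fun ω => ENNReal.ofReal ((X (k ^ 2) ω / (k : ℝ) ^ 2) ^ 2) :=
    fun k => (((hmeas _).div_const _).pow_const 2).ennreal_ofReal
  -- Along squares the normalised second moments are at most `1 / k²`. The random series thus has
  -- finite mean, converges almost surely, and its terms tend to `0`.
  have hfin : ∫⁻ ω, ∑' k : ℕ, ENNReal.ofReal ((X (k ^ 2) ω / (k : ℝ) ^ 2) ^ 2) ∂μ ≠ ⊤ := by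
    rw [lintegral_tsum fun k => (hm k).aemeasurable]
    exact ne_top_of_le_ne_top hsum (ENNReal.tsum_le_tsum hterm)
  filter_upwards [ae_lt_top (Measurable.tsum hm) hfin] with ω hω
  refine tendsto_div_of_tendsto_sq_div (fun n => hinc n ω) ?_
  have h0 := ENNReal.tendsto_atTop_zero_of_tsum_ne_top hω.ne
  have h1 := (ENNReal.tendsto_toReal ENNReal.zero_ne_top).comp (by simpa using h0)
  have h2 : Tendsto (fun k : ℕ => (X (k ^ 2) ω / (k : ℝ) ^ 2) ^ 2) atTop (𝓝 0) := by
    refine h1.congr' (Eventually.of_forall fun k => ?_)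
    simp only [Function.comp_apply]
    exact ENNReal.toReal_ofReal (sq_nonneg _)
  have h3 := h2.sqrt
  simp only [Real.sqrt_sq_eq_abs, Real.sqrt_zero] at h3
  exact (tendsto_zero_iff_abs_tendsto_zero _).2 h3

/-- Adding to an orthogonal process a bounded centred increment that is independent of a discrete
past. -/
lemma integral_add_mul_sq_le {Ω E : Type*} [MeasurableSpace Ω] {μ : Measure Ω}
    [IsProbabilityMeasure μ] [MeasurableSpace E] [DiscreteMeasurableSpace E]
    {Z : Ω → E} {ξ : Ω → ℝ} (hZ : Measurable Z) (hξ : Measurable ξ) (hind : IndepFun Z ξ μ)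
    (hξ1 : ∀ ω, |ξ ω| ≤ 1) (hξ0 : ∫ ω, ξ ω ∂μ = 0) {φ ψ : E → ℝ} {C : ℝ} (hφ : ∀ z, |φ z| ≤ C)
    (hψ : ∀ z, |ψ z| ≤ 1) :
    ∫ ω, (φ (Z ω) + ψ (Z ω) * ξ ω) ^ 2 ∂μ ≤ (∫ ω, φ (Z ω) ^ 2 ∂μ) + 1 := by
  have hφm : Measurable fun ω => φ (Z ω) := (Measurable.of_discrete (f := φ)).comp hZ
  have hψm : Measurable fun ω => ψ (Z ω) := (Measurable.of_discrete (f := ψ)).comp hZ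
  -- Orthogonality: the factor depending on the past is independent of `ξ`, which has mean zero.
  have hcross : ∫ ω, (φ (Z ω) * ψ (Z ω)) * ξ ω ∂μ = 0 := by
    have := (hind.comp (φ := fun z => φ z * ψ z) (ψ := id) Measurable.of_discrete
      measurable_id).integral_fun_mul_eq_mul_integral
      (hφm.mul hψm).aestronglyMeasurable hξ.aestronglyMeasurable
    simp only [Function.comp_apply, id] at this
    rw [this, hξ0, mul_zero]
  have hi1 : Integrable (fun ω => φ (Z ω) ^ 2) μ := by
    refine Integrable.of_bound (hφm.pow_const 2).aestronglyMeasurable (C ^ 2)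
      (ae_of_all _ fun ω => ?_)
    rw [norm_pow, Real.norm_eq_abs]
    exact pow_le_pow_left₀ (abs_nonneg _) (hφ _) 2
  have hψξ : ∀ ω, |ψ (Z ω) * ξ ω| ≤ 1 := fun ω => by
    rw [abs_mul]; exact mul_le_one₀ (hψ _) (abs_nonneg _) (hξ1 _)
  have hi2 : Integrable (fun ω => 2 * ((φ (Z ω) * ψ (Z ω)) * ξ ω)) μ := by
    refine (Integrable.of_bound ((hφm.mul hψm).mul hξ).aestronglyMeasurable C
      (ae_of_all _ fun ω => ?_)).const_mul 2
    rw [Real.norm_eq_abs]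
    calc |φ (Z ω) * ψ (Z ω) * ξ ω| = |φ (Z ω)| * |ψ (Z ω) * ξ ω| := by rw [mul_assoc, abs_mul]
      _ ≤ C * 1 := mul_le_mul (hφ _) (hψξ _) (abs_nonneg _) ((abs_nonneg _).trans (hφ (Z ω)))
      _ = C := mul_one C
  have hi3 : Integrable (fun ω => (ψ (Z ω) * ξ ω) ^ 2) μ := by
    refine Integrable.of_bound ((hψm.mul hξ).pow_const 2).aestronglyMeasurable 1
      (ae_of_all _ fun ω => ?_)
    rw [norm_pow, Real.norm_eq_abs]
    exact pow_le_one₀ (abs_nonneg _) (hψξ ω)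
  have hsplit : ∀ ω, (φ (Z ω) + ψ (Z ω) * ξ ω) ^ 2
      = φ (Z ω) ^ 2 + 2 * ((φ (Z ω) * ψ (Z ω)) * ξ ω) + (ψ (Z ω) * ξ ω) ^ 2 := fun ω => by ring
  simp_rw [hsplit]
  have hi12 : Integrable (fun ω => φ (Z ω) ^ 2 + 2 * ((φ (Z ω) * ψ (Z ω)) * ξ ω)) μ := hi1.add hi2
  rw [integral_add hi12 hi3, integral_add hi1 hi2, integral_const_mul, hcross, mul_zero,
    add_zero]
  gcongr
  calc ∫ ω, (ψ (Z ω) * ξ ω) ^ 2 ∂μ ≤ ∫ _, (1 : ℝ) ∂μ := by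
        refine integral_mono hi3 (integrable_const 1) fun ω => ?_
        rw [← sq_abs]
        exact pow_le_one₀ (abs_nonneg _) (hψξ ω)
    _ = 1 := by simp

/-! ### Compensated sums and visit frequencies of the walk. -/

/-- The set `V` of natural numbers has natural density `d`. -/
def HasNaturalDensity (V : Set ℕ) (d : ℝ) : Prop :=
  Tendsto (fun N : ℕ => (∑ m ∈ Finset.range N, V.indicator (fun _ => (1 : ℝ)) m) / N) atTop (𝓝 d)

lemma indicator_one_nonneg (V : Set ℕ) (m : ℕ) : 0 ≤ V.indicator (fun _ => (1 : ℝ)) m :=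
  Set.indicator_nonneg (fun _ _ => zero_le_one) m

lemma indicator_one_le_one (V : Set ℕ) (m : ℕ) : V.indicator (fun _ => (1 : ℝ)) m ≤ 1 :=
  Set.indicator_le_self' (fun _ _ => zero_le_one) m

lemma abs_indicator_one_le_one (V : Set ℕ) (m : ℕ) : |V.indicator (fun _ => (1 : ℝ)) m| ≤ 1 := by
  rw [abs_of_nonneg (indicator_one_nonneg V m)]
  exact indicator_one_le_one V m

/-- The compensated number of steps that the path with steps `w` makes from a point of `V`. -/
noncomputable def compensatedSum (V : Set ℕ) (α : ℝ) (w : ℕ → ℕ) (n : ℕ) : ℝ :=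
  ∑ i ∈ Finset.range n, V.indicator (fun _ => (1 : ℝ)) (∑ j ∈ Finset.range i, w j) *
    (Set.indicator {1} (fun _ => (1 : ℝ)) (w i) - α)

lemma abs_indicator_sub_le_one {α : ℝ} (hα : 0 ≤ α) (hα1 : α ≤ 1) (s : Set ℕ) (m : ℕ) :
    |s.indicator (fun _ => (1 : ℝ)) m - α| ≤ 1 := by
  have h0 := indicator_one_nonneg s m
  have h1 := indicator_one_le_one s m
  rw [abs_le]
  constructor <;> linarith

lemma abs_compensatedSum_succ_sub_le {α : ℝ} (hα : 0 ≤ α) (hα1 : α ≤ 1) (V : Set ℕ) (w : ℕ → ℕ)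
    (n : ℕ) : |compensatedSum V α w (n + 1) - compensatedSum V α w n| ≤ 1 := by
  rw [compensatedSum, Finset.sum_range_succ, compensatedSum, add_sub_cancel_left, abs_mul]
  exact mul_le_one₀ (abs_indicator_one_le_one _ _) (abs_nonneg _)
    (abs_indicator_sub_le_one hα hα1 _ _)

lemma abs_compensatedSum_le {α : ℝ} (hα : 0 ≤ α) (hα1 : α ≤ 1) (V : Set ℕ) (w : ℕ → ℕ)
    (n : ℕ) : |compensatedSum V α w n| ≤ n := by
  induction n with
  | zero => simp [compensatedSum]
  | succ n ih =>
    have h := abs_compensatedSum_succ_sub_le hα hα1 V w n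
    have h2 := abs_sub_abs_le_abs_sub (compensatedSum V α w (n + 1)) (compensatedSum V α w n)
    push_cast
    linarith

/-- Adaptedness: this lets the sum be read as a function of a finite vector of past steps, to which
independence applies. -/
lemma compensatedSum_congr {V : Set ℕ} {α : ℝ} {w w' : ℕ → ℕ} {n : ℕ}
    (h : ∀ i < n, w i = w' i) : compensatedSum V α w n = compensatedSum V α w' n := by
  refine Finset.sum_congr rfl fun i hi => ?_
  rw [Finset.mem_range] at hi
  rw [h i hi, Finset.sum_congr rfl fun j hj => h j ((Finset.mem_range.1 hj).trans hi)]

/-- The compensated sum counts the points of `V` below the current position of the path. -/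
lemma compensatedSum_eq {V : Set ℕ} {α : ℝ} {w : ℕ → ℕ} (hw : ∀ i, w i = 0 ∨ w i = 1) (n : ℕ) :
    compensatedSum V α w n =
      (∑ m ∈ Finset.range (∑ j ∈ Finset.range n, w j), V.indicator (fun _ => (1 : ℝ)) m) -
      α * ∑ i ∈ Finset.range n, V.indicator (fun _ => (1 : ℝ)) (∑ j ∈ Finset.range i, w j) := by
  induction n with
  | zero => simp [compensatedSum]
  | succ n ih =>
    rw [compensatedSum, Finset.sum_range_succ, ← compensatedSum, ih, Finset.sum_range_succ w,
      Finset.sum_range_succ (fun i => V.indicator (fun _ => (1 : ℝ)) (∑ j ∈ Finset.range i, w j))]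
    -- A zero step adds only the compensator; a unit step also moves the upper end of the count past
    -- the current position.
    rcases hw n with h | h
    · simp [h]
      ring
    · simp [h, Finset.sum_range_succ]
      ring

section Walk

variable {Ω : Type*} [MeasurableSpace Ω] {μ : Measure Ω} {W : ℕ → Ω → ℕ} {α : ℝ}

lemma integral_indicator_sub_eq_zero [IsProbabilityMeasure μ] {X : Ω → ℕ} (hX : Measurable X)
    (hα : 0 ≤ α) (h1 : μ {ω | X ω = 1} = ENNReal.ofReal α) :
    ∫ ω, (Set.indicator {1} (fun _ => (1 : ℝ)) (X ω) - α) ∂μ = 0 := by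
  have hset : MeasurableSet {ω | X ω = 1} := hX (measurableSet_singleton 1)
  have heq : (fun ω => Set.indicator {1} (fun _ => (1 : ℝ)) (X ω))
      = Set.indicator {ω | X ω = 1} (fun _ => (1 : ℝ)) := by
    ext ω; simp [Set.indicator_apply]
  rw [integral_sub, heq, integral_indicator hset]
  · simp [Measure.real, h1, hα]
  · rw [heq]; exact (integrable_const 1).indicator hset
  · exact integrable_const α

lemma measurable_compensatedSum (hW : ∀ i, Measurable (W i)) (V : Set ℕ) (α : ℝ) (n : ℕ) :
    Measurable fun ω => compensatedSum V α (fun i => W i ω) n := by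
  refine Finset.measurable_sum _ fun i _ => ?_
  exact ((Measurable.of_discrete (f := V.indicator fun _ => (1 : ℝ))).comp
    (Finset.measurable_sum (Finset.range i) fun j _ => hW j)).mul
    (((Measurable.of_discrete (f := Set.indicator {1} fun _ => (1 : ℝ))).comp (hW i)).sub_const α)

/-- Each new term is a bounded function of the past times a centred step independent of it, so it
raises the second moment by at most `1`. -/
lemma integral_compensatedSum_sq_le [IsProbabilityMeasure μ] (hW : ∀ i, Measurable (W i))
    (hind : iIndepFun W μ) (hα : 0 ≤ α) (hα1 : α ≤ 1)
    (h1 : ∀ i, μ {ω | W i ω = 1} = ENNReal.ofReal α) (V : Set ℕ) (n : ℕ) :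
    ∫ ω, compensatedSum V α (fun i => W i ω) n ^ 2 ∂μ ≤ n := by
  induction n with
  | zero => simp [compensatedSum]
  | succ n ih =>
    -- The default `0` is never read: only indices below `n` occur.
    let ext : (Finset.range n → ℕ) → ℕ → ℕ := fun z i =>
      if h : i ∈ Finset.range n then z ⟨i, h⟩ else 0
    let Z : Ω → Finset.range n → ℕ := fun ω i => W i ω
    have hext : ∀ ω i, i < n → ext (Z ω) i = W i ω := fun ω i hi => by simp [ext, Z, hi]
    have hZ : Measurable Z := measurable_pi_lambda _ fun i => hW i
    have hξind : IndepFun Z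
        (fun ω => Set.indicator {1} (fun _ => (1 : ℝ)) (W n ω) - α) μ := by
      have := hind.indepFun_finset (Finset.range n) {n} (by simp) hW
      exact this.comp (φ := id)
        (ψ := fun z : ({n} : Finset ℕ) → ℕ =>
          Set.indicator {1} (fun _ => (1 : ℝ)) (z ⟨n, by simp⟩) - α)
        measurable_id Measurable.of_discrete
    have key := integral_add_mul_sq_le hZ
      (((Measurable.of_discrete (f := Set.indicator {1} fun _ => (1 : ℝ))).comp (hW n)).sub_const α)
      hξind
      (fun ω => abs_indicator_sub_le_one hα hα1 _ _)
      (integral_indicator_sub_eq_zero (hW n) hα (h1 n))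
      (φ := fun z => compensatedSum V α (ext z) n)
      (ψ := fun z => V.indicator (fun _ => (1 : ℝ)) (∑ j ∈ Finset.range n, ext z j))
      (fun z => abs_compensatedSum_le hα hα1 V _ n) (fun z => abs_indicator_one_le_one _ _)
    have e1 : ∀ ω, compensatedSum V α (ext (Z ω)) n = compensatedSum V α (fun i => W i ω) n :=
      fun ω => compensatedSum_congr fun i hi => hext ω i hi
    have e2 : ∀ ω, ∑ j ∈ Finset.range n, ext (Z ω) j = ∑ j ∈ Finset.range n, W j ω :=
      fun ω => Finset.sum_congr rfl fun j hj => hext ω j (Finset.mem_range.1 hj)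
    simp only [e1, e2] at key
    have e3 : ∀ ω, compensatedSum V α (fun i => W i ω) (n + 1) = _ := fun ω =>
      Finset.sum_range_succ _ n
    simp only [e3]
    refine key.trans ?_
    push_cast
    linarith

lemma ae_tendsto_compensatedSum_div [IsProbabilityMeasure μ] (hW : ∀ i, Measurable (W i))
    (hind : iIndepFun W μ) (hα : 0 ≤ α) (hα1 : α ≤ 1)
    (h1 : ∀ i, μ {ω | W i ω = 1} = ENNReal.ofReal α) (V : Set ℕ) :
    ∀ᵐ ω ∂μ, Tendsto (fun n : ℕ => compensatedSum V α (fun i => W i ω) n / n) atTop (𝓝 0) := by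
  refine ae_tendsto_div_of_integral_sq_le (measurable_compensatedSum hW V α)
    (fun n ω => abs_compensatedSum_succ_sub_le hα hα1 V _ n) (fun n => ?_)
    (integral_compensatedSum_sq_le hW hind hα hα1 h1 V)
  refine Integrable.of_bound
    ((measurable_compensatedSum hW V α n).pow_const 2).aestronglyMeasurable ((n : ℝ) ^ 2)
    (ae_of_all _ fun ω => ?_)
  rw [norm_pow, Real.norm_eq_abs]
  exact pow_le_pow_left₀ (abs_nonneg _) (abs_compensatedSum_le hα hα1 V _ n) 2

end Walk

/-- A path whose compensated sums over `V` and over `ℕ` are `o(n)` visits `V` with frequency equal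
to the natural density of `V`. -/
lemma tendsto_visitProportion_of_compensatedSum {V : Set ℕ} {d α : ℝ} (hV : HasNaturalDensity V d)
    (hα : 0 < α) {w : ℕ → ℕ} (hw : ∀ i, w i = 0 ∨ w i = 1)
    (hwV : Tendsto (fun n : ℕ => compensatedSum V α w n / n) atTop (𝓝 0))
    (hwu : Tendsto (fun n : ℕ => compensatedSum Set.univ α w n / n) atTop (𝓝 0)) :
    Tendsto (visitProportion V fun i => ∑ j ∈ Finset.range i, w j) atTop (𝓝 d) := by
  set p : ℕ → ℕ := fun i => ∑ j ∈ Finset.range i, w j with hp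
  -- For `V = ℕ` the compensated sum is `p n - α n`.
  have hspeed : Tendsto (fun n : ℕ => (p n : ℝ) / n) atTop (𝓝 α) := by
    have := hwu.add_const α
    rw [zero_add] at this
    refine this.congr' ?_
    filter_upwards [eventually_ne_atTop 0] with n hn
    have hn' : (n : ℝ) ≠ 0 := by exact_mod_cast hn
    rw [compensatedSum_eq hw]
    simp [hp]
    field_simp
    ring
  have hpinf : Tendsto p atTop atTop := by
    have h1 : Tendsto (fun n : ℕ => (p n : ℝ) / n * n) atTop atTop :=
      hspeed.pos_mul_atTop hα tendsto_natCast_atTop_atTop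
    refine tendsto_natCast_atTop_iff.1 (h1.congr' ?_)
    filter_upwards [eventually_ne_atTop 0] with n hn
    have hn' : (n : ℝ) ≠ 0 := by exact_mod_cast hn
    field_simp
  have hcount := (hV.comp hpinf).mul hspeed
  have hmain := ((hcount.sub hwV).div_const α)
  -- Boundary terms: visits are counted at times `1, …, n`, the compensated sum uses `0, …, n - 1`.
  have hend : Tendsto (fun n : ℕ => (V.indicator (fun _ => (1 : ℝ)) (p n) -
      V.indicator (fun _ => (1 : ℝ)) (p 0)) / n) atTop (𝓝 0) := by
    refine squeeze_zero_norm (fun n => ?_) (tendsto_const_div_atTop_nhds_zero_nat (1 : ℝ))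
    rw [Real.norm_eq_abs, abs_div, Nat.abs_cast]
    gcongr
    exact abs_indicator_sub_le_one (indicator_one_nonneg _ _) (indicator_one_le_one _ _) _ _
  have htot := hmain.add hend
  rw [sub_zero, mul_div_cancel_right₀ _ hα.ne', add_zero] at htot
  refine htot.congr' ?_
  filter_upwards [eventually_ne_atTop 0, hpinf.eventually_ne_atTop 0] with n hn hpn
  have hn' : (n : ℝ) ≠ 0 := by exact_mod_cast hn
  have hpn' : (p n : ℝ) ≠ 0 := by exact_mod_cast hpn
  have hshift : ∑ i ∈ Finset.Icc 1 n, V.indicator (fun _ => (1 : ℝ)) (p i) =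
      (∑ i ∈ Finset.range n, V.indicator (fun _ => (1 : ℝ)) (p i)) +
        (V.indicator (fun _ => (1 : ℝ)) (p n) - V.indicator (fun _ => (1 : ℝ)) (p 0)) := by
    clear * -
    induction n with
    | zero => simp
    | succ n ih =>
      rw [Finset.sum_Icc_succ_top (by omega), ih, Finset.sum_range_succ]
      ring
  have hc := compensatedSum_eq (V := V) (α := α) hw n
  simp only [visitProportion, hshift, Function.comp_apply]
  change compensatedSum V α w n = (∑ m ∈ Finset.range (p n), _) -
    α * ∑ i ∈ Finset.range n, V.indicator (fun _ => (1 : ℝ)) (p i) at hc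
  rw [hc]
  field_simp
  ring

/-- An `α`-random walk on `ℕ` almost surely visits a set with frequency equal to the natural density
of that set. -/
theorem IsAlphaRandomWalk.ae_tendsto_visitProportion {Ω : Type*} [MeasurableSpace Ω]
    {μ : Measure Ω} [IsProbabilityMeasure μ] {α : ℝ} (hα : 0 < α) (hα1 : α < 1)
    {P : ℕ → Ω → ℕ} (hP : IsAlphaRandomWalk μ α P) {V : Set ℕ} {d : ℝ}
    (hV : HasNaturalDensity V d) :
    ∀ᵐ ω ∂μ, Tendsto (fun n => visitProportion V (fun i => P i ω) n) atTop (𝓝 d) := by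
  obtain ⟨W, hW, hind, h1, h0, hstep⟩ := hP.step
  have hP' : ∀ ω i, P i ω = ∑ j ∈ Finset.range i, W j ω := by
    intro ω i
    induction i with
    | zero => simpa using hP.start ω
    | succ i ih => rw [hstep, ih, Finset.sum_range_succ]
  -- Other values have probability zero because the two given masses add up to `1`.
  have h01 : ∀ i, ∀ᵐ ω ∂μ, W i ω = 0 ∨ W i ω = 1 := by
    intro i
    have hm0 : MeasurableSet {ω | W i ω = 0} := hW i (measurableSet_singleton 0)
    have hm1 : MeasurableSet {ω | W i ω = 1} := hW i (measurableSet_singleton 1)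
    have hdisj : Disjoint {ω | W i ω = 0} {ω | W i ω = 1} := by
      rw [Set.disjoint_left]
      intro ω h h'
      exact zero_ne_one (h.symm.trans h')
    refine (mem_ae_iff_prob_eq_one (hm0.union hm1)).2 ?_
    rw [measure_union hdisj hm1, h0, h1, ← ENNReal.ofReal_add (by linarith) hα.le]
    simp
  filter_upwards [ae_all_iff.2 h01,
    ae_tendsto_compensatedSum_div hW hind hα.le hα1.le h1 V,
    ae_tendsto_compensatedSum_div hW hind hα.le hα1.le h1 Set.univ] with ω hω hωV hωu
  simp only [hP']
  exact tendsto_visitProportion_of_compensatedSum hV hα hω hωV hωu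

/-! ### Natural density of periodic sets and of their limits. -/

lemma sum_range_indicator_eq_count (V : Set ℕ) [DecidablePred (· ∈ V)] (N : ℕ) :
    ∑ m ∈ Finset.range N, V.indicator (fun _ => (1 : ℝ)) m = Nat.count (· ∈ V) N := by
  simp [Set.indicator_apply, Nat.count_eq_card_filter_range]

/-- A periodic set has natural density equal to its proportion in one period. -/
lemma hasNaturalDensity_of_periodic {V : Set ℕ} [DecidablePred (· ∈ V)] {Q : ℕ} (hQ : 0 < Q)
    (hV : Function.Periodic (· ∈ V) Q) :
    HasNaturalDensity V ((Nat.count (· ∈ V) Q : ℝ) / Q) := by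
  have hQ' : (Q : ℝ) ≠ 0 := by exact_mod_cast hQ.ne'
  -- The discrepancy is itself periodic, hence bounded, hence `o(N)`.
  let f : ℕ → ℝ := fun N => (Nat.count (· ∈ V) N : ℝ) - N * ((Nat.count (· ∈ V) Q : ℝ) / Q)
  have hcount : ∀ N, Nat.count (· ∈ V) (N + Q) = Nat.count (· ∈ V) N + Nat.count (· ∈ V) Q := by
    intro N
    rw [Nat.count_add]
    congr 1
    rw [← Nat.filter_Ico_card_eq_of_periodic N Q _ hV, Nat.count_eq_card_filter_range,
      Finset.range_eq_Ico, ← Finset.card_map (addLeftEmbedding N)]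
    congr 1
    ext x
    simp only [Finset.mem_map, Finset.mem_filter, Finset.mem_Ico, addLeftEmbedding_apply]
    constructor
    · rintro ⟨y, ⟨hy, hyV⟩, rfl⟩
      exact ⟨by omega, hyV⟩
    · rintro ⟨hx, hxV⟩
      obtain ⟨y, rfl⟩ := Nat.exists_eq_add_of_le hx.1
      exact ⟨y, ⟨by omega, hxV⟩, rfl⟩
  have hf : Function.Periodic f Q := by
    intro N
    simp only [f, hcount]
    push_cast
    field_simp
    ring
  have hbound : ∀ N, ‖f N‖ ≤ ∑ r ∈ Finset.range Q, ‖f r‖ := fun N => by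
    rw [← hf.map_mod_nat N]
    exact Finset.single_le_sum (f := fun r => ‖f r‖) (fun r _ => norm_nonneg _)
      (Finset.mem_range.2 (Nat.mod_lt _ hQ))
  have hlim : Tendsto (fun N : ℕ => f N / N) atTop (𝓝 0) := by
    refine squeeze_zero_norm (fun N => ?_)
      (tendsto_const_div_atTop_nhds_zero_nat (∑ r ∈ Finset.range Q, ‖f r‖))
    rw [norm_div, Real.norm_natCast]
    gcongr
    exact hbound N
  have h := hlim.add_const ((Nat.count (· ∈ V) Q : ℝ) / Q)
  rw [zero_add] at h
  refine h.congr' ?_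
  filter_upwards [eventually_ne_atTop 0] with N hN
  have hN' : (N : ℝ) ≠ 0 := by exact_mod_cast hN
  rw [sum_range_indicator_eq_count]
  simp only [f]
  field_simp
  ring

/-- Natural densities pass to limits that are uniform in upper density. -/
lemma hasNaturalDensity_of_approx {V : Set ℕ} {d : ℝ}
    (h : ∀ ε > 0, ∃ (W : Set ℕ) (d' : ℝ), HasNaturalDensity W d' ∧ |d' - d| < ε ∧
      ∀ᶠ N : ℕ in atTop, |(∑ m ∈ Finset.range N, V.indicator (fun _ => (1 : ℝ)) m) / N -
        (∑ m ∈ Finset.range N, W.indicator (fun _ => (1 : ℝ)) m) / N| < ε) :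
    HasNaturalDensity V d := by
  refine Metric.tendsto_nhds.2 fun ε hε => ?_
  obtain ⟨W, d', hW, hd, hN⟩ := h (ε / 3) (by positivity)
  filter_upwards [hN, Metric.tendsto_nhds.1 hW (ε / 3) (by positivity)] with N h1 h2
  rw [Real.dist_eq] at *
  rw [abs_lt] at *
  constructor <;> linarith

/-! ### Density of the sieved set. -/

section Sieve

variable {H : Finset ℤ}

lemma mem_sievedSet_coe_iff {F : Finset ℕ} {n : ℕ} :
    n ∈ sievedSet F H ↔ ∀ g ∈ F, (n : ZMod g) ∉ H.image fun h : ℤ => (h : ZMod g) := by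
  have key : ∀ (g : ℕ) (h : ℤ), ((n : ℤ) ≡ h [ZMOD (g : ℤ)]) ↔ (h : ZMod g) = (n : ZMod g) := by
    intro g h
    rw [← ZMod.intCast_eq_intCast_iff, eq_comm, Int.cast_natCast]
  simp only [sievedSet, Set.mem_ofPred_eq, key, Finset.mem_coe, Finset.mem_image, not_exists,
    not_and]
  exact ⟨fun h' g hg h hh => h' h hh g hg, fun h' h hh g hg => h' g hg h hh⟩

/-- The Chinese remainder theorem for the number of sieved residues in one period. -/
lemma count_sievedSet_prod {F : Finset ℕ} (hF : (F : Set ℕ).Pairwise Nat.Coprime)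
    (hpos : ∀ g ∈ F, 0 < g) [DecidablePred (· ∈ sievedSet F H)] :
    Nat.count (· ∈ sievedSet F H) (∏ g ∈ F, g) = ∏ g ∈ F, (g - residueCount H g) := by
  have hne : ∀ i : F, NeZero (i : ℕ) := fun i => ⟨(hpos i i.2).ne'⟩
  have hcop : Pairwise (Function.onFun Nat.Coprime fun i : F => (i : ℕ)) :=
    fun i j hij => hF i.2 j.2 fun h => hij (Subtype.ext h)
  let e := ZMod.prodEquivPi (fun i : F => (i : ℕ)) hcop
  have hprod : ∏ g ∈ F, g = ∏ i : F, (i : ℕ) := (Finset.prod_coe_sort F fun g => g).symm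
  have hQ : NeZero (∏ i : F, (i : ℕ)) := ⟨Finset.prod_ne_zero_iff.2 fun i _ => (hne i).ne⟩
  have he : ∀ (n : ℕ) (i : F), e n i = n := fun n i => by
    rw [map_natCast]; rfl
  rw [hprod, Nat.count_eq_card_filter_range]
  have hcard : (Fintype.piFinset fun i : F =>
      (H.image fun h : ℤ => (h : ZMod i))ᶜ).card = ∏ g ∈ F, (g - residueCount H g) := by
    rw [Fintype.card_piFinset, ← Finset.prod_coe_sort F]
    refine Finset.prod_congr rfl fun i _ => ?_
    rw [Finset.card_compl, ZMod.card, residueCount]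
  rw [← hcard]
  -- Survivors in one period correspond to tuples of residues whose coordinates each avoid the
  -- classes of `H`.
  refine Finset.card_bij (fun n _ => e n) ?_ ?_ ?_
  · intro n hn
    rw [Finset.mem_filter, mem_sievedSet_coe_iff] at hn
    simp only [Fintype.mem_piFinset, Finset.mem_compl, he]
    exact fun i => hn.2 i i.2
  · intro n hn m hm hnm
    rw [Finset.mem_filter, Finset.mem_range] at hn hm
    have h1 := (ZMod.natCast_eq_natCast_iff' _ _ _).1 (e.injective hnm)
    rwa [Nat.mod_eq_of_lt hn.1, Nat.mod_eq_of_lt hm.1] at h1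
  · intro z hz
    have hval : (((e.symm z).val : ℕ) : ZMod (∏ i : F, (i : ℕ))) = e.symm z :=
      ZMod.natCast_zmod_val _
    have hez : e ((e.symm z).val : ℕ) = z := by rw [hval, e.apply_symm_apply]
    refine ⟨(e.symm z).val, ?_, hez⟩
    rw [Finset.mem_filter, Finset.mem_range, mem_sievedSet_coe_iff]
    refine ⟨ZMod.val_lt _, fun g hg => ?_⟩
    have h1 := Fintype.mem_piFinset.1 hz ⟨g, hg⟩
    rw [Finset.mem_compl, ← hez, he] at h1
    exact h1

/-- Membership has period `∏ g`, and the count in one period factors over the moduli. -/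
lemma hasNaturalDensity_sievedSet_finset {F : Finset ℕ} (hF : (F : Set ℕ).Pairwise Nat.Coprime)
    (hH : IsAdmissible H F) :
    HasNaturalDensity (sievedSet F H) (∏ g ∈ F, (1 - (residueCount H g : ℝ) / g)) := by
  classical
  have hpos : ∀ g ∈ F, 0 < g := fun g hg => (Nat.zero_le _).trans_lt (hH g hg)
  have hper : Function.Periodic (· ∈ sievedSet F H) (∏ g ∈ F, g) := by
    intro n
    refine propext ?_
    simp only [mem_sievedSet_coe_iff]
    refine forall₂_congr fun g hg => ?_
    rw [Nat.cast_add, (ZMod.natCast_eq_zero_iff _ _).2 (Finset.dvd_prod_of_mem _ hg), add_zero]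
  convert hasNaturalDensity_of_periodic (Finset.prod_pos hpos) hper using 1
  rw [count_sievedSet_prod hF hpos, Nat.cast_prod, Nat.cast_prod, ← Finset.prod_div_distrib]
  refine Finset.prod_congr rfl fun g hg => ?_
  have hg0 : (g : ℝ) ≠ 0 := by exact_mod_cast (hpos g hg).ne'
  rw [Nat.cast_sub (hH g hg).le]
  field_simp

/-- The integers below `N` congruent to `h`, other than `h` itself. -/
lemma card_filter_modEq_ne_le {N K g : ℕ} {h : ℤ} (hg : 0 < g) (hK : |h| ≤ K) :
    (((Finset.range N).filter fun m : ℕ => (m : ℤ) ≡ h [ZMOD (g : ℤ)] ∧ (m : ℤ) ≠ h).card : ℝ) ≤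
      2 * (N + K) * (1 / (g : ℝ)) := by
  have hg' : (0 : ℤ) < g := by exact_mod_cast hg
  set L : ℕ := (N + K) / g with hL
  -- The quotient `(m - h) / g` determines `m` and is a nonzero integer of size at most `L`.
  -- Excluding `m = h` removes the quotient `0`, so the bound has no additive constant to be paid
  -- for every modulus.
  have hcard : ((Finset.range N).filter
      fun m : ℕ => (m : ℤ) ≡ h [ZMOD (g : ℤ)] ∧ (m : ℤ) ≠ h).card ≤
      ((Finset.Icc (-L : ℤ) L).erase 0).card := by
    refine Finset.card_le_card_of_injOn (fun m : ℕ => ((m : ℤ) - h) / g) ?_ ?_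
    · intro m hm
      simp only [Finset.coe_filter, Finset.mem_range, Set.mem_ofPred_eq] at hm
      obtain ⟨hmN, hmh, hne⟩ := hm
      obtain ⟨k, hk⟩ := hmh.symm.dvd
      have hk0 : k ≠ 0 := by rintro rfl; simp at hk; omega
      have habs : |k| ≤ L := by
        rw [hL, Int.natCast_div, Int.le_ediv_iff_mul_le hg']
        have h1 : |k| * g = |(m : ℤ) - h| := by
          rw [hk, abs_mul, abs_of_pos hg', mul_comm]
        rw [h1]
        have h2 := abs_sub (m : ℤ) h
        push_cast
        rw [Nat.abs_cast] at h2
        omega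
      simp only [Finset.coe_erase, Finset.coe_Icc, Set.mem_sdiff, Set.mem_Icc, Set.mem_singleton_iff]
      rw [hk, Int.mul_ediv_cancel_left _ hg'.ne']
      exact ⟨abs_le.1 habs, hk0⟩
    · intro m hm m' hm' hmm
      simp only [Finset.coe_filter, Finset.mem_range, Set.mem_ofPred_eq] at hm hm'
      have h1 := Int.ediv_mul_cancel hm.2.1.symm.dvd
      have h2 := Int.ediv_mul_cancel hm'.2.1.symm.dvd
      simp only at hmm
      rw [hmm] at h1
      omega
  have hL2 : ((Finset.Icc (-L : ℤ) L).erase 0).card = 2 * L := by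
    rw [Finset.card_erase_of_mem (by simp), Int.card_Icc]
    omega
  rw [hL2] at hcard
  have hLle : (L : ℝ) ≤ ((N + K : ℕ) : ℝ) / g := Nat.cast_div_le
  calc _ ≤ ((2 * L : ℕ) : ℝ) := by exact_mod_cast hcard
    _ = 2 * (L : ℝ) := by push_cast; ring
    _ ≤ 2 * (((N + K : ℕ) : ℝ) / g) := by gcongr
    _ = _ := by push_cast; ring

/-- Sieving further by moduli whose reciprocals have sum at most `τ` removes few integers. -/
lemma abs_sum_indicator_sievedSet_sub_le {G : Set ℕ} (hpos : ∀ g ∈ G, 0 < g) {F : Finset ℕ}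
    (hFG : (F : Set ℕ) ⊆ G) {K : ℕ} (hK : ∀ h ∈ H, |h| ≤ K) {τ : ℝ}
    (hτ : ∀ t : Finset ℕ, (t : Set ℕ) ⊆ G → Disjoint t F → ∑ g ∈ t, 1 / (g : ℝ) ≤ τ) (N : ℕ) :
    |∑ m ∈ Finset.range N, (sievedSet G H).indicator (fun _ => (1 : ℝ)) m -
      ∑ m ∈ Finset.range N, (sievedSet F H).indicator (fun _ => (1 : ℝ)) m| ≤
      H.card * (1 + 2 * (N + K) * τ) := by
  classical
  have hsub : sievedSet G H ⊆ sievedSet F H := fun n hn h hh g hg => hn h hh g (hFG hg)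
  -- Larger moduli cannot divide a nonzero `m - h` with `m < N`, so only these matter; the integers
  -- `m = h` are counted separately, once for each `h`.
  let t : Finset ℕ := (Finset.range (N + K + 1)).filter fun g => g ∈ G ∧ g ∉ F
  have htG : (t : Set ℕ) ⊆ G := fun g hg => by
    simp only [t, Finset.coe_filter, Set.mem_ofPred_eq] at hg
    exact hg.2.1
  have htF : Disjoint t F := by
    rw [Finset.disjoint_left]
    intro g hg
    simp only [t, Finset.mem_filter] at hg
    exact hg.2.2
  let D : Finset ℕ := (Finset.range N).filter fun m => m ∈ sievedSet F H ∧ m ∉ sievedSet G H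
  have hD : D ⊆ H.biUnion fun h => ((Finset.range N).filter fun m : ℕ => (m : ℤ) = h) ∪
      t.biUnion fun g => (Finset.range N).filter
        fun m : ℕ => (m : ℤ) ≡ h [ZMOD (g : ℤ)] ∧ (m : ℤ) ≠ h := by
    intro m hm
    simp only [D, Finset.mem_filter, Finset.mem_range] at hm
    obtain ⟨hmN, hmF, hmG⟩ := hm
    simp only [sievedSet, Set.mem_ofPred_eq, not_forall, not_not] at hmG
    obtain ⟨h, hh, g, hg, hmod⟩ := hmG
    simp only [Finset.mem_biUnion, Finset.mem_union, Finset.mem_filter, Finset.mem_range]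
    refine ⟨h, hh, ?_⟩
    by_cases hmh : (m : ℤ) = h
    · exact Or.inl ⟨hmN, hmh⟩
    · refine Or.inr ⟨g, ?_, hmN, hmod, hmh⟩
      simp only [t, Finset.mem_filter, Finset.mem_range]
      refine ⟨?_, hg, fun hgF => hmF h hh g hgF hmod⟩
      have h1 : (g : ℤ) ≤ |(m : ℤ) - h| :=
        Int.le_of_dvd (abs_pos.2 (sub_ne_zero.2 hmh)) ((dvd_abs _ _).2 hmod.symm.dvd)
      have h2 := abs_sub (m : ℤ) h
      have h3 := hK h hh
      rw [Nat.abs_cast] at h2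
      omega
  have hone : ∀ h : ℤ, ((Finset.range N).filter fun m : ℕ => (m : ℤ) = h).card ≤ 1 := by
    intro h
    rw [Finset.card_le_one]
    intro a ha b hb
    rw [Finset.mem_filter] at ha hb
    exact_mod_cast ha.2.trans hb.2.symm
  have hcard : (D.card : ℝ) ≤ H.card * (1 + 2 * (N + K) * τ) := by
    calc (D.card : ℝ) ≤ ∑ h ∈ H, (((Finset.range N).filter fun m : ℕ => (m : ℤ) = h).card +
          ∑ g ∈ t, (((Finset.range N).filter
            fun m : ℕ => (m : ℤ) ≡ h [ZMOD (g : ℤ)] ∧ (m : ℤ) ≠ h).card : ℝ)) := by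
          exact_mod_cast (Finset.card_le_card hD).trans (Finset.card_biUnion_le.trans
            (Finset.sum_le_sum fun h _ => (Finset.card_union_le _ _).trans
              (Nat.add_le_add_left Finset.card_biUnion_le _)))
      _ ≤ ∑ h ∈ H, (1 + ∑ g ∈ t, 2 * (N + K) * (1 / (g : ℝ))) := by
          refine Finset.sum_le_sum fun h hh => add_le_add ?_ (Finset.sum_le_sum fun g hg => ?_)
          · exact_mod_cast hone h
          · exact card_filter_modEq_ne_le (hpos g (htG hg)) (hK h hh)
      _ = H.card * (1 + 2 * (N + K) * ∑ g ∈ t, 1 / (g : ℝ)) := by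
          rw [Finset.sum_const, nsmul_eq_mul, Finset.mul_sum]
      _ ≤ _ := by
          gcongr
          exact hτ t htG htF
  refine le_trans (le_of_eq ?_) hcard
  rw [abs_sub_comm, ← Finset.sum_sub_distrib]
  have hterm : ∀ m, (sievedSet F H).indicator (fun _ => (1 : ℝ)) m -
      (sievedSet G H).indicator (fun _ => (1 : ℝ)) m =
      if m ∈ sievedSet F H ∧ m ∉ sievedSet G H then 1 else 0 := by
    intro m
    by_cases h1 : m ∈ sievedSet G H
    · simp [h1, hsub h1]
    · by_cases h2 : m ∈ sievedSet F H <;> simp [h1, h2]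
  simp only [hterm]
  rw [Finset.sum_boole, Nat.abs_cast]

/-- If the reciprocals of the pairwise coprime moduli are summable, the sieved set has natural
density given by the sieve product. -/
theorem hasNaturalDensity_sievedSet {G : Set ℕ} (hG : G.Pairwise Nat.Coprime)
    (hH : IsAdmissible H G) (hsum : Summable fun g : G => 1 / ((g : ℕ) : ℝ))
    (hmul : Multipliable fun g : G => 1 - (residueCount H g : ℝ) / (g : ℕ)) :
    HasNaturalDensity (sievedSet G H) (∏' g : G, (1 - (residueCount H g : ℝ) / (g : ℕ))) := by
  classical
  have hpos : ∀ g ∈ G, 0 < g := fun g hg => (Nat.zero_le _).trans_lt (hH g hg)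
  obtain ⟨K, hK⟩ : ∃ K : ℕ, ∀ h ∈ H, |h| ≤ K := by
    refine ⟨∑ h ∈ H, h.natAbs, fun h hh => ?_⟩
    rw [Int.abs_eq_natAbs]
    exact_mod_cast Finset.single_le_sum (f := Int.natAbs) (fun _ _ => Nat.zero_le _) hh
  refine hasNaturalDensity_of_approx fun ε hε => ?_
  -- Chosen so that the main error `2 |H| τ` is at most `ε / 2`, even when `H` is empty.
  set τ : ℝ := ε / (4 * (H.card + 1)) with hτdef
  have hτ0 : 0 < τ := by positivity
  obtain ⟨s₀, hs₀⟩ := summable_iff_vanishing_norm.1 hsum τ hτ0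
  -- One finite set of moduli both approximates the product and leaves a small tail of reciprocals.
  obtain ⟨s, hs, hss₀⟩ := ((Metric.tendsto_nhds.1 hmul.hasProd ε hε).and
    (eventually_ge_atTop s₀)).exists
  let F : Finset ℕ := s.map (Function.Embedding.subtype _)
  have hFG : (F : Set ℕ) ⊆ G := fun g hg => by
    obtain ⟨x, _, rfl⟩ := Finset.mem_map.1 (Finset.mem_coe.1 hg)
    exact x.2
  refine ⟨sievedSet F H, _, hasNaturalDensity_sievedSet_finset (hG.mono hFG)
    (fun g hg => hH g (hFG hg)), ?_, ?_⟩
  · rw [Finset.prod_map]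
    exact hs
  · have htail : ∀ t : Finset ℕ, (t : Set ℕ) ⊆ G → Disjoint t F → ∑ g ∈ t, 1 / (g : ℝ) ≤ τ := by
      intro t ht htF
      have h1 : Disjoint (t.subtype (· ∈ G)) s₀ := by
        rw [Finset.disjoint_left]
        intro x hx hxs
        exact Finset.disjoint_left.1 htF (Finset.mem_subtype.1 hx)
          (Finset.mem_map_of_mem _ (hss₀ hxs))
      have h2 := (le_abs_self _).trans (hs₀ _ h1).le
      rwa [Finset.sum_subtype_of_mem (fun g : ℕ => 1 / (g : ℝ)) fun x hx => ht hx] at h2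
    have hlim : Tendsto (fun N : ℕ => H.card * (1 + 2 * K * τ) / (N : ℝ)) atTop (𝓝 0) :=
      tendsto_const_div_atTop_nhds_zero_nat _
    filter_upwards [eventually_gt_atTop 0, hlim.eventually_lt_const (half_pos hε)] with N hN hNε
    have hN' : (0 : ℝ) < N := by exact_mod_cast hN
    rw [← sub_div, abs_div, Nat.abs_cast]
    calc _ ≤ H.card * (1 + 2 * (N + K) * τ) / N := by
          gcongr
          exact abs_sum_indicator_sievedSet_sub_le hpos hFG hK htail N
      _ = H.card * (1 + 2 * K * τ) / N + 2 * (H.card * τ) := by field_simp; ring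
      _ < ε / 2 + ε / 2 := by
          refine add_lt_add_of_lt_of_le hNε ?_
          have : (H.card : ℝ) * τ ≤ (H.card + 1) * τ := by gcongr; linarith
          have h3 : (H.card + 1) * τ = ε / 4 := by rw [hτdef]; field_simp
          linarith
      _ = ε := add_halves ε

end Sieve

/-! ### Condition A, summable reciprocals and convergence of the product. -/

lemma subset_distinctProducts (G : Set ℕ) : G ⊆ distinctProducts G :=
  fun g hg => ⟨{g}, by simpa using hg, by simp⟩

/-- A set of natural numbers with counting function `O(n ^ θ)`, `θ < 1`, has summable reciprocals. -/
lemma summable_one_div_of_sum_indicator_isBigO {G : Set ℕ} {θ : ℝ} (hθ : 0 ≤ θ) (hθ1 : θ < 1)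
    (hO : (fun n : ℕ => ∑ k ∈ Finset.Icc 1 n, G.indicator (fun _ => (1 : ℝ)) k)
      =O[atTop] fun n : ℕ => (n : ℝ) ^ θ) :
    Summable fun g : G => 1 / ((g : ℕ) : ℝ) := by
  -- The reciprocals are the terms of the Dirichlet series of the indicator of `G` at `s = 1 > θ`.
  have h := LSeriesSummable_of_sum_norm_bigO_and_nonneg (s := 1) hO (indicator_one_nonneg G) hθ
    (by simpa using hθ1)
  have h1 := h.norm
  refine (h1.comp_injective (i := ((↑) : G → ℕ)) Subtype.val_injective).congr fun g => ?_
  rcases eq_or_ne (g : ℕ) 0 with h0 | h0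
  · simp [h0]
  · simp [LSeries.term_of_ne_zero h0]

/-- Condition A for the truncated products bounds the counting function of the moduli. -/
lemma sum_indicator_isBigO_of_conditionA {G : Set ℕ} {A B ε θ : ℝ} (hB : 0 < B) (hε : 0 < ε)
    (hεA : ε < A) (hθ : 0 < θ)
    (hA : ∃ C : ℝ, ∀ᶠ n : ℕ in atTop,
      ConditionA C A B ε θ (n : ℝ) (truncatedProducts G A (n : ℝ))) :
    (fun n : ℕ => ∑ k ∈ Finset.Icc 1 n, G.indicator (fun _ => (1 : ℝ)) k)
      =O[atTop] fun n : ℕ => (n : ℝ) ^ θ := by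
  classical
  obtain ⟨C, hC⟩ := hA
  have hA0 : 0 < A := hε.trans hεA
  have hlog : ∀ᶠ n : ℕ in atTop, 1 ≤ Real.log ((n : ℝ) ^ A) :=
    (Real.tendsto_log_atTop.comp ((tendsto_rpow_atTop hA0).comp
      tendsto_natCast_atTop_atTop)).eventually_ge_atTop 1
  have hpow : ∀ᶠ n : ℕ in atTop, C * (n : ℝ) ^ ε ≤ (n : ℝ) ^ A := by
    have h1 : Tendsto (fun n : ℕ => (n : ℝ) ^ (A - ε)) atTop atTop :=
      (tendsto_rpow_atTop (sub_pos.2 hεA)).comp tendsto_natCast_atTop_atTop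
    filter_upwards [h1.eventually_ge_atTop C, eventually_gt_atTop 0] with n hn hn0
    have hn0' : (0 : ℝ) < n := by exact_mod_cast hn0
    calc C * (n : ℝ) ^ ε ≤ (n : ℝ) ^ (A - ε) * (n : ℝ) ^ ε := by gcongr
      _ = (n : ℝ) ^ A := by rw [← Real.rpow_add hn0', sub_add_cancel]
  have hceil : Tendsto (fun N : ℕ => ⌈(N : ℝ) ^ A⁻¹⌉₊) atTop atTop :=
    tendsto_nat_ceil_atTop.comp ((tendsto_rpow_atTop (inv_pos.2 hA0)).comp
      tendsto_natCast_atTop_atTop)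
  refine Asymptotics.IsBigO.of_bound (|C| * ((2 : ℝ) ^ A) ^ θ) ?_
  filter_upwards [hceil.eventually hC, hceil.eventually hlog, hceil.eventually hpow,
    eventually_ge_atTop 1] with N hCN hlogN hpowN hN1
  -- The least `n` with `N ≤ n ^ A`. Condition A is used at `y = n ^ A`, admissible since `ε < A`;
  -- rounding up costs only the factor `2 ^ A`, and the logarithm is discarded.
  set n : ℕ := ⌈(N : ℝ) ^ A⁻¹⌉₊ with hn
  have hN1' : (1 : ℝ) ≤ N := by exact_mod_cast hN1
  have hroot : 1 ≤ (N : ℝ) ^ A⁻¹ := Real.one_le_rpow hN1' (inv_nonneg.2 hA0.le)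
  have hNn : (N : ℝ) ≤ (n : ℝ) ^ A := by
    calc (N : ℝ) = ((N : ℝ) ^ A⁻¹) ^ A := (Real.rpow_inv_rpow (by positivity) hA0.ne').symm
      _ ≤ (n : ℝ) ^ A := by gcongr; exact Nat.le_ceil _
  have hnN : (n : ℝ) ^ A ≤ (2 : ℝ) ^ A * N := by
    have h1 : (n : ℝ) ≤ 2 * (N : ℝ) ^ A⁻¹ := by
      have := Nat.ceil_lt_add_one (a := (N : ℝ) ^ A⁻¹) (by positivity)
      linarith
    calc (n : ℝ) ^ A ≤ (2 * (N : ℝ) ^ A⁻¹) ^ A := by gcongr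
      _ = (2 : ℝ) ^ A * N := by
        rw [Real.mul_rpow (by norm_num) (by positivity),
          Real.rpow_inv_rpow (by positivity) hA0.ne']
  have hcard := hCN.card_le ((n : ℝ) ^ A) hpowN
  have hfin : {a ∈ truncatedProducts G A (n : ℝ) | (a : ℝ) ≤ (n : ℝ) ^ A}.Finite :=
    (Set.finite_Iic ⌊(n : ℝ) ^ A⌋₊).subset fun a ha => Nat.le_floor ha.2
  have hsub : (((Finset.Icc 1 N).filter (· ∈ G) : Finset ℕ) : Set ℕ) ⊆
      {a ∈ truncatedProducts G A (n : ℝ) | (a : ℝ) ≤ (n : ℝ) ^ A} := by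
    intro a ha
    rw [Finset.mem_coe, Finset.mem_filter, Finset.mem_Icc] at ha
    have haN : (a : ℝ) ≤ (n : ℝ) ^ A := le_trans (by exact_mod_cast ha.1.2) hNn
    exact ⟨⟨subset_distinctProducts G ha.2, haN⟩, haN⟩
  have hcount : ∑ k ∈ Finset.Icc 1 N, G.indicator (fun _ => (1 : ℝ)) k ≤
      (Set.ncard {a ∈ truncatedProducts G A (n : ℝ) | (a : ℝ) ≤ (n : ℝ) ^ A} : ℝ) := by
    have h1 := Set.ncard_le_ncard hsub hfin
    rw [Set.ncard_coe_finset] at h1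
    simp only [Set.indicator_apply, Finset.sum_boole]
    exact_mod_cast h1
  rw [Real.norm_of_nonneg (Finset.sum_nonneg fun k _ => indicator_one_nonneg G k),
    Real.norm_of_nonneg (by positivity)]
  have hlogB : 1 ≤ Real.log ((n : ℝ) ^ A) ^ B := Real.one_le_rpow hlogN hB.le
  calc _ ≤ C * (((n : ℝ) ^ A) ^ θ / Real.log ((n : ℝ) ^ A) ^ B) := hcount.trans hcard
    _ ≤ |C| * (((n : ℝ) ^ A) ^ θ / Real.log ((n : ℝ) ^ A) ^ B) := by
        gcongr
        exact le_abs_self C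
    _ ≤ |C| * ((n : ℝ) ^ A) ^ θ := by
        gcongr
        exact div_le_self (by positivity) hlogB
    _ ≤ |C| * ((2 : ℝ) ^ A * N) ^ θ := by gcongr
    _ = |C| * ((2 : ℝ) ^ A) ^ θ * (N : ℝ) ^ θ := by
        rw [Real.mul_rpow (by positivity) (by positivity), mul_assoc]

/-- Each factor differs from `1` by at most `|H| / g`, so the product converges absolutely. -/
lemma multipliable_one_sub_residueCount_div {G : Set ℕ} (H : Finset ℤ)
    (hsum : Summable fun g : G => 1 / ((g : ℕ) : ℝ)) :
    Multipliable fun g : G => 1 - (residueCount H g : ℝ) / (g : ℕ) := by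
  have hle : ∀ g : ℕ, residueCount H g ≤ H.card := fun g => Finset.card_image_le
  have h : Summable fun g : G => ‖-((residueCount H g : ℝ) / (g : ℕ))‖ := by
    refine Summable.of_nonneg_of_le (fun _ => norm_nonneg _) (fun g => ?_)
      (hsum.mul_left (H.card : ℝ))
    rw [norm_neg, norm_div, Real.norm_natCast, Real.norm_natCast, mul_one_div]
    gcongr
    exact hle g
  simpa only [sub_eq_add_neg] using multipliable_one_add_of_summable h

theorem theorem1p5
    (G : Set ℕ) (hG : G.Pairwise Nat.Coprime)
    (H : Finset ℤ) (hH : IsAdmissible H G)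
    (A B ε θ : ℝ) (hB : 0 < B) (hε : 0 < ε) (hεA : ε < A) (hθ : 0 < θ) (hθ1 : θ < 1)
    (hA : ∃ C : ℝ, ∀ᶠ n : ℕ in atTop,
      ConditionA C A B ε θ (n : ℝ) (truncatedProducts G A (n : ℝ)))
    (α : ℝ) (hα : 0 < α) (hα1 : α < 1)
    {Ω : Type*} [MeasurableSpace Ω] (μ : Measure Ω) [IsProbabilityMeasure μ]
    (P : ℕ → Ω → ℕ) (hP : IsAlphaRandomWalk μ α P) :
    Multipliable (fun g : G => 1 - (residueCount H g : ℝ) / (g : ℕ)) ∧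
    ∀ᵐ ω ∂μ, Tendsto (fun n : ℕ => visitProportion (sievedSet G H) (fun i => P i ω) n) atTop
      (𝓝 (∏' g : G, (1 - (residueCount H g : ℝ) / (g : ℕ)))) := by
  have hsum := summable_one_div_of_sum_indicator_isBigO hθ.le hθ1
    (sum_indicator_isBigO_of_conditionA hB hε hεA hθ hA)
  have hmul := multipliable_one_sub_residueCount_div H hsum
  exact ⟨hmul, hP.ae_tendsto_visitProportion hα hα1 (hasNaturalDensity_sievedSet hG hH hsum hmul)⟩
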